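/- Let $\Sigma=\{a_1,\dots,a_n\}$ be a finite alphabet ($n\ge 0$). Simple types are generated from one base type $o$ by $\Rightarrow$, and $\Lambda(A)$ is the set of closed simply typed $\lambda$-terms of type $A$ modulo $\beta\eta$-conversion. For a finite set $Q$ let $[\![o]\!]_Q=Q$ and let $[\![A\Rightarrow B]\!]_Q$ be the set of all functions $[\![A]\!]_Q\to[\![B]\!]_Q$; let $[\![M]\!]_Q\in[\![A]\!]_Q$ be the usual interpretation of $M\in\Lambda(A)$, and let $[\![A]\!]^{\bullet}_Q=\{[\![M]\!]_Q : M\in\Lambda(A)\}$ be the set of definable elements. A partial surjection $f:Q\twoheadrightarrow Q'$ is a relation $f\subseteq Q\times Q'$ that is the graph of a surjective partial function; it generates a logical relation $[\![A]\!]_f\subseteq[\![A]\!]_Q\times[\![A]\!]_{Q'}$ by $[\![o]\!]_f=f$ and $g\,[\![A\Rightarrow B]\!]_f\,h$ iff $x\,[\![A]\!]_f\,y$ implies $g(x)\,[\![B]\!]_f\,h(y)$. Restricted to definable elements, $[\![A]\!]_f$ is a function $[\![A]\!]^{\bullet}_f:[\![A]\!]^{\bullet}_Q\to[\![A]\!]^{\bullet}_{Q'}$.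 The space $\widehat{\Lambda}(A)$ of profinite $\lambda$-terms of type $A$ is the limit of these maps: the set of families $(\theta_Q)_Q$, indexed by the finite sets $Q$, with $\theta_Q\in[\![A]\!]^{\bullet}_Q$ and $[\![A]\!]^{\bullet}_f(\theta_Q)=\theta_{Q'}$ for every partial surjection $f:Q\twoheadrightarrow Q'$ of finite sets, with the subspace topology of the product of the discrete spaces $[\![A]\!]^{\bullet}_Q$. The space $\widehat{\Sigma^*}$ of profinite words over $\Sigma$ is the limit of the discrete finite quotients $\Sigma^*/\varphi$ over the finite-index congruences $\varphi$ of $\Sigma^*$ ordered by inclusion, again with the subspace topology of the product. Let $\mathrm{Church}_\Sigma$ be the type $(o\Rightarrow o)^n\Rightarrow o\Rightarrow o$, that is, $(o\Rightarrow o)\Rightarrow\cdots\Rightarrow(o\Rightarrow o)\Rightarrow o\Rightarrow o$ with $n=|\Sigma|$ arguments of type $o\Rightarrow o$. Theorem C. For every finite alphabet $\Sigma$ there is a homeomorphism $$\widehat{\Lambda}(\mathrm{Church}_\Sigma)\;\cong\;\widehat{\Sigma^*}$$ between the space of profinite $\lambda$-terms of type $\mathrm{Church}_\Sigma$ and the space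 of profinite words over $\Sigma$. It can be chosen to extend the Church encoding: for every finite word $w=a_{w_1}\cdots a_{w_k}\in\Sigma^*$ it sends the profinite $\lambda$-term $([\![M_w]\!]_Q)_Q$ of the Church encoding $M_w=\lambda a_1\dots\lambda a_n.\lambda c.\,a_{w_k}(\cdots(a_{w_1}c))$ to the profinite word $([w]_\varphi)_\varphi$. -/

import Mathlib

namespace ProfiniteLambda

/-! ### Simple types and simply typed terms -/

/-- Simple types over a single base type `o`. -/
inductive SType : Type
  | o : SType
  | arrow : SType → SType → SType

infixr:25 " ⇒ " => SType.arrow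

/-- Typing contexts; the most recently bound variable comes first. -/
abbrev Ctx : Type := List SType

/-- (de Bruijn) variables of type `A` in the context `Γ`. -/
inductive Var : Ctx → SType → Type
  | zero {Γ : Ctx} {A : SType} : Var (A :: Γ) A
  | succ {Γ : Ctx} {A B : SType} : Var Γ A → Var (B :: Γ) A

/-- Simply typed terms `Γ ⊢ M : A`, up to renaming of bound variables. -/
inductive Term : Ctx → SType → Type
  | var {Γ : Ctx} {A : SType} : Var Γ A → Term Γ A
  | app {Γ : Ctx} {A B : SType} : Term Γ (A ⇒ B) → Term Γ A → Term Γ B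
  | lam {Γ : Ctx} {A B : SType} : Term (A :: Γ) B → Term Γ (A ⇒ B)

/-- Extension of a renaming under a binder. -/
def liftRen {Γ Δ : Ctx} {B : SType} (ρ : ∀ A, Var Γ A → Var Δ A) :
    ∀ A, Var (B :: Γ) A → Var (B :: Δ) A
  | _, Var.zero => Var.zero
  | _, Var.succ v => Var.succ (ρ _ v)

/-- Renaming of variables. -/
def rename : ∀ {Γ Δ : Ctx} {A : SType}, (∀ B, Var Γ B → Var Δ B) → Term Γ A → Term Δ A
  | _, _, _, ρ, Term.var v => Term.var (ρ _ v)
  | _, _, _, ρ, Term.app M N => Term.app (rename ρ M) (rename ρ N)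
  | _, _, _, ρ, Term.lam M => Term.lam (rename (liftRen ρ) M)

/-- Weakening by one fresh variable. -/
def weaken {Γ : Ctx} {A B : SType} (M : Term Γ A) : Term (B :: Γ) A :=
  rename (fun _ v => Var.succ v) M

/-- Extension of a substitution under a binder. -/
def liftSub {Γ Δ : Ctx} {B : SType} (σ : ∀ A, Var Γ A → Term Δ A) :
    ∀ A, Var (B :: Γ) A → Term (B :: Δ) A
  | _, Var.zero => Term.var Var.zero
  | _, Var.succ v => weaken (σ _ v)

/-- Simultaneous capture-avoiding substitution. -/
def subst : ∀ {Γ Δ : Ctx} {A : SType}, (∀ B, Var Γ B → Term Δ B) → Term Γ A → Term Δ A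
  | _, _, _, σ, Term.var v => σ _ v
  | _, _, _, σ, Term.app M N => Term.app (subst σ M) (subst σ N)
  | _, _, _, σ, Term.lam M => Term.lam (subst (liftSub σ) M)

/-- The substitution that replaces the last variable by `N` and fixes the others. -/
def single {Γ : Ctx} {B : SType} (N : Term Γ B) : ∀ A, Var (B :: Γ) A → Term Γ A
  | _, Var.zero => N
  | _, Var.succ v => Term.var v

/-- `βη`-conversion: the least congruence containing `β` and `η`. -/
inductive Conv : ∀ {Γ : Ctx} {A : SType}, Term Γ A → Term Γ A → Prop
  | beta {Γ : Ctx} {A B : SType} (M : Term (A :: Γ) B) (N : Term Γ A) :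
      Conv (Term.app (Term.lam M) N) (subst (single N) M)
  | eta {Γ : Ctx} {A B : SType} (M : Term Γ (A ⇒ B)) :
      Conv M (Term.lam (Term.app (weaken M) (Term.var Var.zero)))
  | app {Γ : Ctx} {A B : SType} {M M' : Term Γ (A ⇒ B)} {N N' : Term Γ A} :
      Conv M M' → Conv N N' → Conv (Term.app M N) (Term.app M' N')
  | lam {Γ : Ctx} {A B : SType} {M M' : Term (A :: Γ) B} :
      Conv M M' → Conv (Term.lam M) (Term.lam M')
  | refl {Γ : Ctx} {A : SType} (M : Term Γ A) : Conv M M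
  | symm {Γ : Ctx} {A : SType} {M N : Term Γ A} : Conv M N → Conv N M
  | trans {Γ : Ctx} {A : SType} {M N P : Term Γ A} : Conv M N → Conv N P → Conv M P

/-- `βη`-conversion on the closed terms of type `A`. -/
def convSetoid (A : SType) : Setoid (Term [] A) where
  r := Conv
  iseqv := ⟨Conv.refl, Conv.symm, Conv.trans⟩

/-- The set `Λ(A)` of closed terms of type `A` modulo `βη`-conversion. -/
def ClosedTerm (A : SType) : Type := Quotient (convSetoid A)

/-! ### The standard model -/

/-- The interpretation `⟦A⟧_Q` of a simple type as a set. -/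
def SType.sem (Q : Type) : SType → Type
  | SType.o => Q
  | SType.arrow A B => SType.sem Q A → SType.sem Q B

/-- Valuations of the variables of a context, i.e. elements of `⟦A₁⟧_Q × ⋯ × ⟦Aₙ⟧_Q`. -/
def Env (Q : Type) (Γ : Ctx) : Type := ∀ A, Var Γ A → A.sem Q

/-- Extension of a valuation by a value for a new variable. -/
def Env.cons {Q : Type} {Γ : Ctx} {B : SType} (x : B.sem Q) (η : Env Q Γ) : Env Q (B :: Γ)
  | _, Var.zero => x
  | _, Var.succ v => η _ v

/-- The empty valuation. -/
def Env.nil {Q : Type} : Env Q [] := fun _ v => nomatch v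

/-- The interpretation of terms in context. -/
def Term.sem {Q : Type} : ∀ {Γ : Ctx} {A : SType}, Term Γ A → Env Q Γ → A.sem Q
  | _, _, Term.var v, η => η _ v
  | _, _, Term.app M N, η => (Term.sem M η) (Term.sem N η)
  | _, _, Term.lam M, η => fun x => Term.sem M (Env.cons x η)

theorem sem_rename {Q : Type} {Γ : Ctx} {A : SType} (M : Term Γ A) :
    ∀ {Δ : Ctx} (ρ : ∀ B, Var Γ B → Var Δ B) (η : Env Q Δ),
      (rename ρ M).sem η = M.sem (fun B v => η B (ρ B v)) := by
  induction M with
  | var v => intro Δ ρ η; rfl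
  | app M N ihM ihN => intro Δ ρ η; simp only [rename, Term.sem, ihM, ihN]
  | lam M ih =>
    intro Δ ρ η
    simp only [rename, Term.sem, ih]
    funext x
    congr 1
    funext B v
    cases v <;> rfl

theorem sem_subst {Q : Type} {Γ : Ctx} {A : SType} (M : Term Γ A) :
    ∀ {Δ : Ctx} (σ : ∀ B, Var Γ B → Term Δ B) (η : Env Q Δ),
      (subst σ M).sem η = M.sem (fun B v => (σ B v).sem η) := by
  induction M with
  | var v => intro Δ σ η; rfl
  | app M N ihM ihN => intro Δ σ η; simp only [subst, Term.sem, ihM, ihN]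
  | lam M ih =>
    intro Δ σ η
    simp only [subst, Term.sem, ih]
    funext x
    congr 1
    funext B v
    cases v with
    | zero => rfl
    | succ v => simp only [liftSub, weaken, sem_rename]; rfl

theorem sem_conv {Q : Type} {Γ : Ctx} {A : SType} {M N : Term Γ A} (h : Conv M N) :
    ∀ η : Env Q Γ, M.sem η = N.sem η := by
  induction h with
  | beta M N =>
    intro η
    rw [sem_subst]
    simp only [Term.sem]
    congr 1
    funext B v
    cases v <;> rfl
  | eta M =>
    intro η
    simp only [Term.sem, weaken, sem_rename]
    rfl
  | app _ _ ih₁ ih₂ => intro η; simp only [Term.sem, ih₁, ih₂]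
  | lam _ ih => intro η; simp only [Term.sem, ih]; rfl
  | refl _ => intro η; rfl
  | symm _ ih => intro η; exact (ih η).symm
  | trans _ _ ih₁ ih₂ => intro η; exact (ih₁ η).trans (ih₂ η)

/-- The semantic bracket `⟦-⟧_Q : Λ(A) → ⟦A⟧_Q`. -/
def ClosedTerm.sem {A : SType} (Q : Type) (M : ClosedTerm A) : A.sem Q :=
  Quotient.lift (s := convSetoid A) (fun M : Term [] A => M.sem (Env.nil (Q := Q)))
    (fun _ _ h => sem_conv h _) M

/-! ### Logical relations and partial surjections -/

/-- The logical relation `⟦A⟧_R` between `⟦A⟧_Q` and `⟦A⟧_Q'` generated by `R`. -/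
def semRel {Q Q' : Type} (R : Q → Q' → Prop) : ∀ A : SType, A.sem Q → A.sem Q' → Prop
  | SType.o => R
  | SType.arrow A B => fun g h =>
      ∀ (x : A.sem Q) (y : A.sem Q'), semRel R A x y → semRel R B (g x) (h y)

/-- Partial surjections: the graphs of surjective partial functions. -/
structure IsPartialSurj {X Y : Type} (R : X → Y → Prop) : Prop where
  functional : ∀ x y y', R x y → R x y' → y = y'
  surjective : ∀ y, ∃ x, R x y

/-- Fundamental lemma of logical relations. -/
theorem semRel_term {Q Q' : Type} (R : Q → Q' → Prop) {Γ : Ctx} {A : SType} (M : Term Γ A) :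
    ∀ (η : Env Q Γ) (η' : Env Q' Γ), (∀ B v, semRel R B (η B v) (η' B v)) →
      semRel R A (M.sem η) (M.sem η') := by
  induction M with
  | var v => intro η η' h; exact h _ v
  | app M N ihM ihN => intro η η' h; exact ihM η η' h _ _ (ihN η η' h)
  | lam M ih =>
    intro η η' h x y hxy
    refine ih _ _ fun B v => ?_
    cases v with
    | zero => exact hxy
    | succ v => exact h _ v

theorem semRel_closed {Q Q' : Type} (R : Q → Q' → Prop) {A : SType} (M : ClosedTerm A) :
    semRel R A (M.sem Q) (M.sem Q') :=
  Quotient.inductionOn (s := convSetoid A) M fun M => semRel_term R M _ _ fun _ v => nomatch v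

theorem sem_nonempty {Q : Type} [Nonempty Q] : ∀ A : SType, Nonempty (A.sem Q)
  | SType.o => ‹Nonempty Q›
  | SType.arrow _ B => have := sem_nonempty (Q := Q) B; ⟨fun _ => Classical.choice this⟩

/-- Over an empty set of states, logical relations are bijections. -/
theorem semRel_of_isEmpty {Q Q' : Type} [IsEmpty Q] [IsEmpty Q'] (R : Q → Q' → Prop) :
    ∀ A : SType, ∃ e : A.sem Q ≃ A.sem Q', ∀ x y, semRel R A x y ↔ e x = y
  | SType.o => ⟨Equiv.equivOfIsEmpty Q Q', fun x => isEmptyElim (α := Q) x⟩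
  | SType.arrow A B => by
    obtain ⟨a, ha⟩ := semRel_of_isEmpty R A
    obtain ⟨b, hb⟩ := semRel_of_isEmpty R B
    refine ⟨Equiv.arrowCongr a b, fun g h => ?_⟩
    simp only [semRel, ha, hb, forall_eq']
    constructor
    · intro H
      funext y
      have := H (a.symm y)
      rw [a.apply_symm_apply] at this
      exact this
    · rintro rfl x
      exact congrArg (fun z => b (g z)) (a.symm_apply_apply x).symm

/-- The logical relation generated by a partial surjection is a partial surjection. -/
theorem IsPartialSurj.semRel {Q Q' : Type} {R : Q → Q' → Prop} (hR : IsPartialSurj R)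
    (A : SType) : IsPartialSurj (semRel R A) := by
  rcases isEmpty_or_nonempty Q with hQ | hQ
  · have hQ' : IsEmpty Q' := ⟨fun y => (hR.surjective y).elim fun x _ => hQ.elim x⟩
    obtain ⟨e, he⟩ := semRel_of_isEmpty R A
    refine ⟨fun x y y' h h' => ?_, fun y => ⟨e.symm y, (he _ _).2 (e.apply_symm_apply y)⟩⟩
    exact ((he _ _).1 h).symm.trans ((he _ _).1 h')
  · induction A with
    | o => exact hR
    | arrow A B hA hB =>
      refine ⟨fun g h h' H H' => ?_, fun h => ?_⟩
      · funext y
        obtain ⟨x, hx⟩ := hA.surjective y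
        exact hB.functional _ _ _ (H x y hx) (H' x y hx)
      · have key : ∀ x : A.sem Q, ∃ z : B.sem Q, ∀ y, ProfiniteLambda.semRel R A x y →
            ProfiniteLambda.semRel R B z (h y) := by
          intro x
          by_cases hx : ∃ y, ProfiniteLambda.semRel R A x y
          · obtain ⟨y, hy⟩ := hx
            obtain ⟨z, hz⟩ := hB.surjective (h y)
            refine ⟨z, fun y' hy' => ?_⟩
            rw [← hA.functional _ _ _ hy hy']
            exact hz
          · obtain ⟨z⟩ := sem_nonempty (Q := Q) B
            exact ⟨z, fun y hy => (hx ⟨y, hy⟩).elim⟩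
        choose g hg using key
        exact ⟨g, fun x y hxy => hg x y hxy⟩

/-! ### Profinite terms -/

/-- The set of definable elements of `⟦A⟧_Q`. -/
def Definable (A : SType) (Q : Type) : Type := {x : A.sem Q // ∃ M : ClosedTerm A, M.sem Q = x}

/-- A closed term, as a definable element. -/
def ClosedTerm.toDefinable {A : SType} (M : ClosedTerm A) (Q : Type) : Definable A Q :=
  ⟨M.sem Q, M, rfl⟩

theorem exists_definable_semRel {A : SType} {Q Q' : Type} (R : Q → Q' → Prop)
    (x : Definable A Q) : ∃ y : Definable A Q', semRel R A x.1 y.1 := by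
  obtain ⟨x, M, rfl⟩ := x
  exact ⟨M.toDefinable Q', semRel_closed R M⟩

/-- The map `Definable A Q → Definable A Q'` that a partial surjection from `Q` to `Q'` induces:
the restriction of the logical relation to definable elements. -/
noncomputable def definableMap (A : SType) {Q Q' : Type} {R : Q → Q' → Prop}
    (_hR : IsPartialSurj R) (x : Definable A Q) : Definable A Q' :=
  (exists_definable_semRel R x).choose

theorem definableMap_eq_iff {A : SType} {Q Q' : Type} {R : Q → Q' → Prop}
    (hR : IsPartialSurj R) (x : Definable A Q) (y : Definable A Q') :
    definableMap A hR x = y ↔ semRel R A x.1 y.1 := by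
  have h : semRel R A x.1 (definableMap A hR x).1 := (exists_definable_semRel R x).choose_spec
  exact ⟨fun e => e ▸ h, fun h' => Subtype.ext ((hR.semRel A).functional _ _ _ h h')⟩

theorem definableMap_toDefinable {A : SType} {Q Q' : Type} {R : Q → Q' → Prop}
    (hR : IsPartialSurj R) (M : ClosedTerm A) :
    definableMap A hR (M.toDefinable Q) = M.toDefinable Q' :=
  (definableMap_eq_iff hR _ _).2 (semRel_closed R M)

/-- Finite sets of states. -/
def FinSet : Type 1 := {Q : Type // Finite Q}

/-- The limit of the finite sets of definable elements of type `A`, over all finite sets and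
partial surjections: the profinite terms of type `A`. -/
def ProfiniteTerm (A : SType) : Type 1 :=
  {θ : ∀ Q : FinSet, Definable A Q.1 //
    ∀ (Q Q' : FinSet) (R : Q.1 → Q'.1 → Prop) (hR : IsPartialSurj R),
      definableMap A hR (θ Q) = θ Q'}

/-- The subspace topology from the product of the discrete spaces `Definable A Q`. -/
instance (A : SType) : TopologicalSpace (ProfiniteTerm A) :=
  TopologicalSpace.induced Subtype.val (@Pi.topologicalSpace FinSet _ fun _ => ⊥)

/-- A closed term, as a profinite term. -/
def ClosedTerm.toProfinite {A : SType} (M : ClosedTerm A) : ProfiniteTerm A :=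
  ⟨fun Q => M.toDefinable Q.1, fun _ _ _ hR => definableMap_toDefinable hR M⟩

/-! ### Profinite words -/

/-- Congruences of finite index on the free monoid of words over `α`. -/
def FinIndexCon (α : Type*) : Type _ := {φ : Con (FreeMonoid α) // Finite φ.Quotient}

/-- Profinite words over `α`: the limit of the finite quotients of the free monoid of words. -/
def ProfiniteWord (α : Type*) : Type _ :=
  {x : ∀ φ : FinIndexCon α, φ.1.Quotient //
    ∀ (φ φ' : FinIndexCon α) (h : φ.1 ≤ φ'.1), Con.map φ.1 φ'.1 h (x φ) = x φ'}

/-- The subspace topology from the product of the discrete finite quotients. -/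
instance (α : Type*) : TopologicalSpace (ProfiniteWord α) :=
  TopologicalSpace.induced Subtype.val (@Pi.topologicalSpace (FinIndexCon α) _ fun _ => ⊥)

/-- A finite word, as a profinite word. -/
def toProfiniteWord {α : Type*} (w : FreeMonoid α) : ProfiniteWord α :=
  ⟨fun _ => (w : Con.Quotient _), fun _ _ _ => rfl⟩

/-! ### Church encoding of words -/

/-- The type `o ⇒ o` of a letter. -/
abbrev letterType : SType := SType.o ⇒ SType.o

/-- The type `(o ⇒ o) ⇒ ⋯ ⇒ (o ⇒ o) ⇒ B`, with `n` arguments of type `o ⇒ o`. -/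
def letterArrow : ℕ → SType → SType
  | 0, B => B
  | n + 1, B => letterArrow n (letterType ⇒ B)

/-- The Church type `(o ⇒ o)ⁿ ⇒ o ⇒ o` of words over an alphabet with `n` letters. -/
def churchType (n : ℕ) : SType := letterArrow n (SType.o ⇒ SType.o)

/-- The context that declares `n` variables of type `o ⇒ o`. -/
def letterCtx : ℕ → Ctx
  | 0 => []
  | n + 1 => letterType :: letterCtx n

/-- The variable at distance `i` from the end of the context. -/
def letterVar : ∀ n : ℕ, Fin n → Var (letterCtx n) letterType
  | _ + 1, ⟨0, _⟩ => Var.zero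
  | n + 1, ⟨i + 1, h⟩ => Var.succ (letterVar n ⟨i, Nat.lt_of_succ_lt_succ h⟩)

/-- `n`-fold abstraction `M ↦ λ a₁ … aₙ. M`. -/
def lamLetters : ∀ (n : ℕ) {B : SType}, Term (letterCtx n) B → Term [] (letterArrow n B)
  | 0, _, M => M
  | n + 1, _, M => lamLetters n (Term.lam M)

/-- The Church encoding `λ a₁ … aₙ. λ c. a_{w_k} (⋯ (a_{w_1} c))` of a word `w₁ ⋯ w_k`.
The variable `a₁` is bound first, so it is the furthest one in the context. -/
def churchTerm {n : ℕ} (w : List (Fin n)) : Term [] (churchType n) :=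
  lamLetters n (Term.lam (w.foldl
    (fun M i => Term.app (Term.var (Var.succ (letterVar n i.rev))) M) (Term.var Var.zero)))

/-- The Church encoding of a word over an alphabet `α` enumerated as `a 0, …, a (n - 1)`,
modulo `βη`-conversion. -/
def church {n : ℕ} {α : Type*} (a : Fin n ≃ α) (w : FreeMonoid α) : ClosedTerm (churchType n) :=
  Quotient.mk (convSetoid _) (churchTerm ((FreeMonoid.toList w).map a.symm))

end ProfiniteLambda

namespace ProfiniteLambda

/-! ### Elements of the Church type as functions of letters -/

/-! Over a finite set `Q`, an element of the Church type is determined by its values at the actions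
of the letters on `Q`, and the encoding of a word has as value the action of that word. Every closed
term of the Church type has the interpretations of some encoded word (`exists_church_sem_eq`), so
the definable elements over `Q` are exactly the classes of `actCon α Q`
(`toDefinable_church_eq_iff`).

These congruences have finite index and are cofinal: a congruence of finite index contains that of
its own quotient, on which words act by right multiplication (`actCon_quotientSet_le`). Hence both
limits carry the same data. Compatibility transfers because a profinite term agrees with one word on
any two finite sets (`ProfiniteTerm.exists_church_toDefinable_eq`), and because a partial surjection
can only coarsen the congruence (`actCon_le_of_isPartialSurj`). -/

/-- Application to `n` letters; `g i` is the argument at distance `i` from the last one. -/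
def applyLetters {Q : Type} :
    ∀ (n : ℕ) {B : SType}, (letterArrow n B).sem Q → (Fin n → Q → Q) → B.sem Q
  | 0, _, x, _ => x
  | n + 1, B, x, g => applyLetters n (B := letterType ⇒ B) x (fun i => g i.succ) (g 0)

/-- The valuation of the `n` letter variables by `n` functions. -/
def letterEnv {Q : Type} : ∀ n : ℕ, (Fin n → Q → Q) → Env Q (letterCtx n)
  | 0, _ => Env.nil
  | n + 1, g => Env.cons (B := letterType) (g 0) (letterEnv n fun i => g i.succ)

theorem letterEnv_letterVar {Q : Type} :
    ∀ (n : ℕ) (g : Fin n → Q → Q) (i : Fin n), letterEnv n g letterType (letterVar n i) = g i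
  | _ + 1, _, ⟨0, _⟩ => rfl
  | n + 1, g, ⟨i + 1, h⟩ =>
    letterEnv_letterVar n (fun i => g i.succ) ⟨i, Nat.lt_of_succ_lt_succ h⟩

theorem applyLetters_lamLetters {Q : Type} :
    ∀ (n : ℕ) {B : SType} (M : Term (letterCtx n) B) (g : Fin n → Q → Q),
      applyLetters n ((lamLetters n M).sem Env.nil) g = M.sem (letterEnv n g)
  | 0, _, _, _ => rfl
  | n + 1, _, M, g =>
    congrFun (applyLetters_lamLetters n (Term.lam M) fun i => g i.succ) (g 0)

theorem applyLetters_injective {Q : Type} :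
    ∀ (n : ℕ) {B : SType} (x y : (letterArrow n B).sem Q),
      (∀ g, applyLetters n x g = applyLetters n y g) → x = y
  | 0, _, _, _, h => h Fin.elim0
  | n + 1, B, x, y, h =>
    applyLetters_injective n (B := letterType ⇒ B) x y fun g =>
      funext fun k => h (Fin.cons (α := fun _ => Q → Q) k g)

theorem semRel_applyLetters {Q Q' : Type} (R : Q → Q' → Prop) :
    ∀ (n : ℕ) {B : SType} (x : (letterArrow n B).sem Q) (y : (letterArrow n B).sem Q')
      (g : Fin n → Q → Q) (g' : Fin n → Q' → Q'),
      semRel R (letterArrow n B) x y → (∀ i, semRel R letterType (g i) (g' i)) →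
      semRel R B (applyLetters n x g) (applyLetters n y g')
  | 0, _, _, _, _, _, h, _ => h
  | n + 1, B, x, y, _, _, h, hg =>
    semRel_applyLetters R n (B := letterType ⇒ B) x y _ _ h (fun i => hg i.succ) _ _ (hg 0)

/-! ### Words acting on states, and their Church encodings -/

/-- The action of words on states generated by an action of the letters, read from left to
right. -/
def wordAct {α : Type*} {Q : Type} (f : α → Q → Q) (w : FreeMonoid α) (q : Q) : Q :=
  (FreeMonoid.toList w).foldl (fun q i => f i q) q

theorem wordAct_mul {α : Type*} {Q : Type} (f : α → Q → Q) (v w : FreeMonoid α) (q : Q) :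
    wordAct f (v * w) q = wordAct f w (wordAct f v q) := by
  simp only [wordAct, FreeMonoid.toList_mul, List.foldl_append]

/-- The accumulator `M` is arbitrary because each letter read by the fold wraps it in one more
application. -/
theorem sem_foldl_app {Q : Type} {n : ℕ} (g : Fin n → Q → Q) (c : Q) (l : List (Fin n)) :
    ∀ M : Term (SType.o :: letterCtx n) SType.o,
      (l.foldl (fun M i => Term.app (Term.var (Var.succ (letterVar n i.rev))) M) M).sem
          (Env.cons (B := SType.o) c (letterEnv n g)) =
        l.foldl (fun q i => g i.rev q) (M.sem (Env.cons (B := SType.o) c (letterEnv n g))) := by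
  induction l with
  | nil => intro M; rfl
  | cons i l ih =>
    intro M
    exact (ih _).trans (congrArg (fun q => l.foldl (fun q i => g i.rev q) q)
      (congrFun (letterEnv_letterVar n g i.rev) _))

section Church

variable {n : ℕ} {α : Type*} (a : Fin n ≃ α)

/-- Application of an element of the Church type to an interpretation of the letters. -/
def churchApply {Q : Type} (x : (churchType n).sem Q) (f : α → Q → Q) : Q → Q :=
  -- `applyLetters` counts from the last argument, while `a 0` is the letter bound first; hence the
  -- reversal.
  applyLetters n (B := SType.o ⇒ SType.o) x fun i => f (a i.rev)

theorem churchApply_church {Q : Type} (w : FreeMonoid α) (f : α → Q → Q) (q : Q) :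
    churchApply a ((church a w).sem Q) f q = wordAct f w q := by
  refine (congrFun (applyLetters_lamLetters n _ fun i => f (a i.rev)) q).trans ?_
  refine (sem_foldl_app _ q _ _).trans ?_
  change ((FreeMonoid.toList w).map a.symm).foldl (fun q i => f (a i.rev.rev) q) q = _
  simp only [List.foldl_map, Fin.rev_rev, Equiv.apply_symm_apply]
  rfl

theorem churchApply_injective {Q : Type} {x y : (churchType n).sem Q}
    (h : ∀ (f : α → Q → Q) (q : Q), churchApply a x f q = churchApply a y f q) : x = y := by
  refine applyLetters_injective n x y fun g => funext fun q => ?_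
  -- Every family `g` comes from an interpretation of the letters, since `a` and `Fin.rev` are
  -- bijections.
  have := h (fun b => g (a.symm b).rev) q
  simp only [churchApply, Equiv.symm_apply_apply, Fin.rev_rev] at this
  exact this

theorem church_sem_eq_iff {Q : Type} (v w : FreeMonoid α) :
    (church a v).sem Q = (church a w).sem Q ↔
      ∀ (f : α → Q → Q) (q : Q), wordAct f v q = wordAct f w q := by
  refine ⟨fun h f q => ?_, fun h => churchApply_injective a fun f q => ?_⟩
  · rw [← churchApply_church a, h, churchApply_church]
  · rw [churchApply_church, churchApply_church, h]

/-- Every closed term of the Church type has the same interpretations as the encoding of some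
word, namely its value at the letters acting on the set of words. -/
theorem exists_church_sem_eq (M : ClosedTerm (churchType n)) :
    ∃ w : FreeMonoid α, ∀ Q : Type, (church a w).sem Q = M.sem Q := by
  -- The word is read off `M` in a model whose states are words: each letter appends itself,
  -- starting from the empty word. Lists over `Fin n` lie in `Type` whatever the universe of `α`.
  let u : List (Fin n) :=
    churchApply a (M.sem (List (Fin n))) (fun b (l : List (Fin n)) => l ++ [a.symm b]) []
  refine ⟨FreeMonoid.ofList (u.map a), fun Q => churchApply_injective a fun f q => ?_⟩
  -- A word is related to the state it reaches from `q`, so appending a letter matches acting by it.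
  -- The fundamental lemma, valid for any relation, then relates `u` to the value of `M` at `f` and
  -- `q`.
  let R : List (Fin n) → Q → Prop := fun l s => wordAct f (FreeMonoid.ofList (l.map a)) q = s
  have h : semRel R (SType.o ⇒ SType.o) _ _ :=
    semRel_applyLetters R n (M.sem (List (Fin n))) (M.sem Q)
      (fun i (l : List (Fin n)) => l ++ [a.symm (a i.rev)]) (fun i => f (a i.rev))
      (semRel_closed R M) (by
        rintro i (l : List (Fin n)) s (rfl : wordAct f (FreeMonoid.ofList (l.map a)) q = s)
        change wordAct f (FreeMonoid.ofList ((l ++ [a.symm (a i.rev)]).map a)) q = _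
        simp [wordAct])
  rw [churchApply_church]
  exact h [] q rfl

theorem exists_toDefinable_eq {Q : Type} (x : Definable (churchType n) Q) :
    ∃ w : FreeMonoid α, (church a w).toDefinable Q = x := by
  obtain ⟨x, M, rfl⟩ := x
  obtain ⟨w, hw⟩ := exists_church_sem_eq a M
  exact ⟨w, Subtype.ext (hw Q)⟩

/-- A word whose encoding is the given definable element of the Church type. -/
noncomputable def definableWord {Q : Type} (x : Definable (churchType n) Q) : FreeMonoid α :=
  (exists_toDefinable_eq a x).choose

theorem toDefinable_definableWord {Q : Type} (x : Definable (churchType n) Q) :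
    (church a (definableWord a x)).toDefinable Q = x :=
  (exists_toDefinable_eq a x).choose_spec

end Church

/-! ### The congruence of a finite set of states -/

/-- Two words are congruent when they act equally on `Q` for every interpretation of the
letters. -/
def actCon (α : Type*) (Q : Type) : Con (FreeMonoid α) where
  r v w := ∀ (f : α → Q → Q) (q : Q), wordAct f v q = wordAct f w q
  iseqv := ⟨fun _ _ _ => rfl, fun h f q => (h f q).symm, fun h k f q => (h f q).trans (k f q)⟩
  mul' h k f q := by rw [wordAct_mul, wordAct_mul, h, k]

/-- A class is determined by how its words act under all interpretations of the letters, which is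
one of finitely many functions. -/
theorem finite_actCon_quotient (α : Type*) [Finite α] (Q : Type) [Finite Q] :
    Finite (actCon α Q).Quotient := by
  let F : (actCon α Q).Quotient → (α → Q → Q) → Q → Q :=
    Quotient.lift (s := (actCon α Q).toSetoid) (fun w f q => wordAct f w q)
      fun _ _ h => funext fun f => funext fun q => h f q
  refine Finite.of_injective F fun x y => ?_
  induction x, y using Con.induction_on₂ with
  | H v w => exact fun h => (Con.eq _).2 fun f q => congrFun (congrFun h f) q

/-- The congruence of a finite set of states, as a congruence of finite index. -/
def finActCon (α : Type*) [Finite α] (Q : FinSet) : FinIndexCon α :=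
  ⟨actCon α Q.1, have := Q.2; finite_actCon_quotient α Q.1⟩

theorem toDefinable_church_eq_iff {n : ℕ} {α : Type*} (a : Fin n ≃ α) {Q : Type}
    (v w : FreeMonoid α) :
    (church a v).toDefinable Q = (church a w).toDefinable Q ↔ actCon α Q v w :=
  Subtype.ext_iff.trans (church_sem_eq_iff a v w)

/-- A standard finite set of the size of the quotient by a congruence. -/
def quotientSet {α : Type*} (φ : FinIndexCon α) : FinSet :=
  -- The quotient itself lives in the universe of `α`, whereas sets of states lie in `Type`.
  ⟨Fin (Nat.card φ.1.Quotient), inferInstance⟩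

/-- The enumeration of the quotient by a congruence of finite index. -/
noncomputable def quotientEquiv {α : Type*} (φ : FinIndexCon α) :
    φ.1.Quotient ≃ (quotientSet φ).1 :=
  have := φ.2; Finite.equivFin φ.1.Quotient

/-- A congruence of finite index is coarser than the congruence of its quotient, on which words
act by right multiplication. -/
theorem actCon_quotientSet_le {α : Type*} (φ : FinIndexCon α) :
    actCon α (quotientSet φ).1 ≤ φ.1 := by
  let e := quotientEquiv φ
  let f : α → (quotientSet φ).1 → (quotientSet φ).1 := fun b q =>
    e (e.symm q * (FreeMonoid.of b : FreeMonoid α))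
  have key : ∀ w v : FreeMonoid α, wordAct f w (e v) = e ((v * w : FreeMonoid α)) := by
    intro w
    induction w using FreeMonoid.recOn with
    | one => intro v; rw [mul_one]; rfl
    | of_mul b w ih =>
      intro v
      rw [wordAct_mul, ← mul_assoc, ← ih]
      congr 1
      change e (e.symm (e v) * (FreeMonoid.of b : FreeMonoid α)) = _
      rw [Equiv.symm_apply_apply]
      rfl
  intro v w h
  -- Started at the class of the empty word, a word leads to its own class.
  have := h f (e (1 : FreeMonoid α))
  rw [key, key, one_mul, one_mul] at this
  exact (Con.eq _).1 (e.injective this)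

/-! ### Profinite terms of the Church type and profinite words -/

/-- The inverse of an injection, as a partial surjection. -/
theorem isPartialSurj_of_injective {X Y : Type} {g : X → Y} (hg : Function.Injective g) :
    IsPartialSurj fun y x => g x = y :=
  ⟨fun _ _ _ h h' => hg (h.trans h'.symm), fun x => ⟨g x, rfl⟩⟩

section Homeomorph

variable {n : ℕ} {α : Type*} (a : Fin n ≃ α)

theorem ProfiniteTerm.toDefinable_of_isPartialSurj {A : SType} (θ : ProfiniteTerm A)
    {Q Q' : FinSet} {R : Q.1 → Q'.1 → Prop} (hR : IsPartialSurj R) {M : ClosedTerm A}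
    (h : M.toDefinable Q.1 = θ.1 Q) : M.toDefinable Q'.1 = θ.1 Q' := by
  rw [← θ.2 Q Q' R hR, ← h, definableMap_toDefinable]

/-- A profinite term agrees with a single term on any two finite sets. -/
theorem ProfiniteTerm.exists_toDefinable_eq {A : SType} (θ : ProfiniteTerm A) (Q Q' : FinSet) :
    ∃ M : ClosedTerm A, M.toDefinable Q.1 = θ.1 Q ∧ M.toDefinable Q'.1 = θ.1 Q' := by
  have := Q.2
  have := Q'.2
  -- The disjoint union maps onto both sets by the inverses of the two injections, so a term
  -- defining `θ` there serves both.
  let S : FinSet := ⟨Q.1 ⊕ Q'.1, inferInstance⟩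
  obtain ⟨M, hM⟩ := (θ.1 S).2
  have hS : M.toDefinable S.1 = θ.1 S := Subtype.ext hM
  exact ⟨M, θ.toDefinable_of_isPartialSurj (isPartialSurj_of_injective Sum.inl_injective) hS,
    θ.toDefinable_of_isPartialSurj (isPartialSurj_of_injective Sum.inr_injective) hS⟩

theorem ProfiniteTerm.exists_church_toDefinable_eq (θ : ProfiniteTerm (churchType n))
    (Q Q' : FinSet) : ∃ w : FreeMonoid α,
      (church a w).toDefinable Q.1 = θ.1 Q ∧ (church a w).toDefinable Q'.1 = θ.1 Q' := by
  obtain ⟨M, h, h'⟩ := θ.exists_toDefinable_eq Q Q'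
  obtain ⟨w, hw⟩ := exists_church_sem_eq a M
  exact ⟨w, h ▸ Subtype.ext (hw _), h' ▸ Subtype.ext (hw _)⟩

/-! ### Translation between definable elements and classes of words -/

/-- The class of the word encoded by a definable element over the quotient set. -/
noncomputable def definableClass (φ : FinIndexCon α)
    (x : Definable (churchType n) (quotientSet φ).1) : φ.1.Quotient :=
  (definableWord a x : FreeMonoid α)

/-- The chosen word does not matter: words with equal encodings over the quotient set act equally on
it, hence are congruent modulo `φ`. -/
theorem definableClass_toDefinable (φ : FinIndexCon α) (w : FreeMonoid α) :
    definableClass a φ ((church a w).toDefinable _) = (w : φ.1.Quotient) :=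
  (Con.eq _).2 (actCon_quotientSet_le φ
    ((toDefinable_church_eq_iff a _ _).1 (toDefinable_definableWord a _)))

/-- The definable element encoding a class of words acting equally on `Q`. -/
def classDefinable (Q : Type) (c : (actCon α Q).Quotient) : Definable (churchType n) Q :=
  Quotient.lift (s := (actCon α Q).toSetoid) (fun w => (church a w).toDefinable Q)
    (fun _ _ h => (toDefinable_church_eq_iff a _ _).2 h) c

/-- The profinite word encoded by a profinite term of the Church type. -/
noncomputable def ProfiniteTerm.toWord (θ : ProfiniteTerm (churchType n)) : ProfiniteWord α :=
  ⟨fun φ => definableClass a φ (θ.1 (quotientSet φ)), fun φ φ' hle => by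
    -- With one word representing `θ` over both sets, the two sides are classes of the same word.
    obtain ⟨w, h, h'⟩ := θ.exists_church_toDefinable_eq a (quotientSet φ) (quotientSet φ')
    change Con.map φ.1 φ'.1 hle (definableClass a φ (θ.1 (quotientSet φ))) =
      definableClass a φ' (θ.1 (quotientSet φ'))
    rw [← h, ← h', definableClass_toDefinable, definableClass_toDefinable]
    rfl⟩

/-- Two words acting equally on `Q` have the same encoding there, and `definableMap` carries this to
equal encodings over `Q'`. -/
theorem actCon_le_of_isPartialSurj (a : Fin n ≃ α) {Q Q' : Type} {R : Q → Q' → Prop} (hR : IsPartialSurj R) :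
    actCon α Q ≤ actCon α Q' := by
  intro v w h
  rw [← toDefinable_church_eq_iff a] at h ⊢
  rw [← definableMap_toDefinable hR, h, definableMap_toDefinable hR]

theorem ProfiniteWord.exists_coe_eq (x : ProfiniteWord α) {φ φ' : FinIndexCon α}
    (h : φ.1 ≤ φ'.1) : ∃ w : FreeMonoid α, (w : φ.1.Quotient) = x.1 φ ∧
      (w : φ'.1.Quotient) = x.1 φ' := by
  obtain ⟨w, hw⟩ := Con.mk'_surjective (x.1 φ)
  refine ⟨w, hw, ?_⟩
  rw [← x.2 φ φ' h, ← hw]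
  rfl

/-- The profinite term of the Church type that encodes a profinite word. -/
noncomputable def ProfiniteWord.toTerm [Finite α] (x : ProfiniteWord α) :
    ProfiniteTerm (churchType n) :=
  ⟨fun Q => classDefinable a Q.1 (x.1 (finActCon α Q)), fun Q Q' R hR => by
    obtain ⟨w, h, h'⟩ := x.exists_coe_eq (φ := finActCon α Q) (φ' := finActCon α Q')
      (actCon_le_of_isPartialSurj a hR)
    change definableMap _ hR (classDefinable a Q.1 (x.1 (finActCon α Q))) =
      classDefinable a Q'.1 (x.1 (finActCon α Q'))
    rw [← h, ← h']
    exact definableMap_toDefinable hR _⟩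

theorem ProfiniteWord.toWord_toTerm [Finite α] (x : ProfiniteWord α) :
    (x.toTerm a).toWord a = x := by
  refine Subtype.ext (funext fun φ => ?_)
  obtain ⟨w, h, h'⟩ := x.exists_coe_eq (φ := finActCon α (quotientSet φ)) (φ' := φ)
    (actCon_quotientSet_le φ)
  change definableClass a φ (classDefinable a _ (x.1 (finActCon α (quotientSet φ)))) = _
  rw [← h, ← h']
  exact definableClass_toDefinable a φ w

theorem ProfiniteTerm.toTerm_toWord [Finite α] (θ : ProfiniteTerm (churchType n)) :
    (θ.toWord a).toTerm a = θ := by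
  refine Subtype.ext (funext fun Q => ?_)
  -- The round trip reads `θ` at a set other than `Q`; a common word compares the two values.
  obtain ⟨w, h, h'⟩ := θ.exists_church_toDefinable_eq a Q (quotientSet (finActCon α Q))
  change classDefinable a Q.1 (definableClass a (finActCon α Q) (θ.1 _)) = _
  rw [← h, ← h', definableClass_toDefinable]
  rfl

/-! ### Continuity: each coordinate of the image depends on a single discrete coordinate of the
argument -/

theorem ProfiniteTerm.continuous_toWord :
    Continuous (ProfiniteTerm.toWord a : ProfiniteTerm (churchType n) → ProfiniteWord α) := by
  let (Q : FinSet) : TopologicalSpace (Definable (churchType n) Q.1) := ⊥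
  have (Q : FinSet) : DiscreteTopology (Definable (churchType n) Q.1) := ⟨rfl⟩
  let (φ : FinIndexCon α) : TopologicalSpace φ.1.Quotient := ⊥
  refine continuous_induced_rng.2 (continuous_pi fun φ => ?_)
  exact (continuous_of_discreteTopology (f := definableClass a φ)).comp
    ((continuous_apply (quotientSet φ)).comp continuous_induced_dom)

theorem ProfiniteWord.continuous_toTerm [Finite α] :
    Continuous (ProfiniteWord.toTerm a : ProfiniteWord α → ProfiniteTerm (churchType n)) := by
  let (Q : FinSet) : TopologicalSpace (Definable (churchType n) Q.1) := ⊥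
  let (φ : FinIndexCon α) : TopologicalSpace φ.1.Quotient := ⊥
  have (φ : FinIndexCon α) : DiscreteTopology φ.1.Quotient := ⟨rfl⟩
  refine continuous_induced_rng.2 (continuous_pi fun Q => ?_)
  exact (continuous_of_discreteTopology
    (f := fun c : (finActCon α Q).1.Quotient => classDefinable a Q.1 c)).comp
    ((continuous_apply (finActCon α Q)).comp continuous_induced_dom)

/-- Profinite terms of the Church type are profinite words. -/
noncomputable def churchHomeomorph [Finite α] :
    ProfiniteTerm (churchType n) ≃ₜ ProfiniteWord α where
  toFun := ProfiniteTerm.toWord a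
  invFun := ProfiniteWord.toTerm a
  left_inv := ProfiniteTerm.toTerm_toWord a
  right_inv := ProfiniteWord.toWord_toTerm a
  continuous_toFun := ProfiniteTerm.continuous_toWord a
  continuous_invFun := ProfiniteWord.continuous_toTerm a

end Homeomorph

end ProfiniteLambda

theorem theoremC {n : ℕ} {α : Type*} (a : Fin n ≃ α) :
    ∃ Φ : ProfiniteLambda.ProfiniteTerm (ProfiniteLambda.churchType n) ≃ₜ
        ProfiniteLambda.ProfiniteWord α,
      ∀ w : FreeMonoid α,
        Φ (ProfiniteLambda.church a w).toProfinite = ProfiniteLambda.toProfiniteWord w := by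
  have : Finite α := Finite.of_equiv _ a
  exact ⟨ProfiniteLambda.churchHomeomorph a, fun w => Subtype.ext (funext fun φ =>
    ProfiniteLambda.definableClass_toDefinable a φ w)⟩
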